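/- Let $t>0$ and let $H\colon[0,t]\to\mathbb{C}^{n\times n}$ be a time-dependent Hamiltonian: each $H(\tau)$ is Hermitian and nonzero, $H$ is continuous except at finitely many points of $[0,t]$, and $H$ is integrable, so that $$\|H\|_{\infty,1}:=\int_0^t\|H(\tau)\|_\infty\,\mathrm{d}\tau<\infty,$$ where $\|\cdot\|_\infty$ is the spectral norm. Let $$\mathrm{E}(\tau,0)=\exp_{\mathcal T}\Bigl(-i\int_0^\tau H(\sigma)\,\mathrm{d}\sigma\Bigr)=\sum_{k\ge 0}(-i)^k\int_{0\le\tau_1\le\cdots\le\tau_k\le\tau}H(\tau_k)\cdots H(\tau_1)\,\mathrm{d}\tau_1\cdots\mathrm{d}\tau_k$$ be the time-ordered exponential, and let $\mathcal{E}(t,0)(\rho)=\mathrm{E}(t,0)\,\rho\,\mathrm{E}(t,0)^\dagger$ be the ideal evolution channel. Put $p(\tau)=\|H(\tau)\|_\infty/\|H\|_{\infty,1}$ and let $\mathcal{U}(t,0)$ be the continuous qDRIFT channel, the mixed-unitary channel $$\mathcal{U}(t,0)(\rho)=\int_0^t p(\tau)\,e^{-iH(\tau)/p(\tau)}\,\rho\,e^{iH(\tau)/p(\tau)}\,\mathrm{d}\tau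 .$$ Then these objects are well defined: $\mathrm{E}(0,0)=I$, the map $\tau\mapsto\mathrm{E}(\tau,0)$ is continuous on $[0,t]$ and satisfies $\frac{\mathrm{d}}{\mathrm{d}\tau}\mathrm{E}(\tau,0)=-iH(\tau)\mathrm{E}(\tau,0)$ at every $\tau\in(0,t)$ at which $H$ is continuous, and the integral defining $\mathcal{U}(t,0)(\rho)$ converges absolutely for every matrix $\rho$. Moreover $$\|\mathcal{E}(t,0)-\mathcal{U}(t,0)\|_\diamond\le 4\,\|H\|_{\infty,1}^2 .$$ Here, for a linear map $\Phi$ on $\mathbb{C}^{n\times n}$, the diamond norm is $\|\Phi\|_\diamond=\max\{\|(\Phi\otimes\mathrm{id})(B)\|_1:\|B\|_1\le1\}$, where $B$ ranges over the matrices on $\mathbb{C}^n\otimes\mathbb{C}^n$, $\mathrm{id}$ is the identity map on $\mathbb{C}^{n\times n}$, and $\|B\|_1=\operatorname{Tr}\sqrt{B^\dagger B}$. -/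

import Mathlib

open MeasureTheory Set
open scoped Matrix MatrixOrder Matrix.Norms.L2Operator ComplexOrder

noncomputable section

/-! Throughout, the norm `‖A‖` of a complex matrix `A` is the spectral norm (the operator norm for
the Euclidean norm on vectors), which is the Schatten `∞`-norm. -/

section TimeOrderedExponential

variable {n : Type*} [Fintype n] [DecidableEq n]

/-- The terms of the Dyson series of a matrix-valued function `A` with initial time `s`: the
`k`-th one at time `τ` is the iterated integral of `A τₖ * ⋯ * A τ₁` over
`s ≤ τ₁ ≤ ⋯ ≤ τₖ ≤ τ`. -/
def dysonTerm (A : ℝ → Matrix n n ℂ) (s : ℝ) : ℕ → ℝ → Matrix n n ℂ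
  | 0 => fun _ => 1
  | k + 1 => fun τ => ∫ σ in s..τ, A σ * dysonTerm A s k σ

/-- The time-ordered exponential of the integral of `A` from `s` to `τ`, as the sum of its
Dyson series. -/
def timeOrderedExp (A : ℝ → Matrix n n ℂ) (s τ : ℝ) : Matrix n n ℂ :=
  ∑' k : ℕ, dysonTerm A s k τ

/-- The evolution operator from time `0` to time `τ` generated by the Hamiltonian `H`, the
time-ordered exponential of the integral of `-i H` from `0` to `τ`. -/
def evolution (H : ℝ → Matrix n n ℂ) (τ : ℝ) : Matrix n n ℂ :=
  timeOrderedExp (fun σ => -Complex.I • H σ) 0 τ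

end TimeOrderedExponential

section Norms

variable {n : Type*} [Fintype n] [DecidableEq n]

/-- The trace norm (Schatten `1`-norm), the trace of the positive square root of `Aᴴ * A`
(a nonnegative real number). -/
def traceNorm (A : Matrix n n ℂ) : ℝ :=
  (CFC.sqrt (Aᴴ * A)).trace.re

/-- The action of `Φ ⊗ id` on a matrix `B` over the tensor product of the space with a second copy
of itself (the ancilla): `Φ` is applied to each block of `B` with fixed ancilla indices. -/
def tensorId (Φ : Matrix n n ℂ →ₗ[ℂ] Matrix n n ℂ) (B : Matrix (n × n) (n × n) ℂ) :
    Matrix (n × n) (n × n) ℂ :=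
  Matrix.of fun x y => Φ (Matrix.of fun i j => B (i, x.2) (j, y.2)) x.1 y.1

/-- The diamond norm of a linear map on matrices. -/
def diamondNorm (Φ : Matrix n n ℂ →ₗ[ℂ] Matrix n n ℂ) : ℝ :=
  sSup {r : ℝ | ∃ B : Matrix (n × n) (n × n) ℂ, traceNorm B ≤ 1 ∧ r = traceNorm (tensorId Φ B)}

/-- The norm `‖H‖_{∞,1}` on `[0, t]`: the integral of the spectral norm. -/
def normInftyOne (H : ℝ → Matrix n n ℂ) (t : ℝ) : ℝ :=
  ∫ τ in (0 : ℝ)..t, ‖H τ‖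

end Norms

section Channels

variable {n : Type*} [Fintype n] [DecidableEq n]

/-- The ideal channel `ρ ↦ E(t,0) ρ E(t,0)†`. -/
def idealChannel (H : ℝ → Matrix n n ℂ) (t : ℝ) : Matrix n n ℂ →L[ℂ] Matrix n n ℂ :=
  ContinuousLinearMap.mulLeftRight ℂ (Matrix n n ℂ) (evolution H t) (evolution H t)ᴴ

/-- The sampling density `p(τ) = ‖H(τ)‖ / ‖H‖_{∞,1}` of continuous qDRIFT. -/
def qdriftDensity (H : ℝ → Matrix n n ℂ) (t τ : ℝ) : ℝ :=
  ‖H τ‖ / normInftyOne H t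

/-- The unitary `e^{-i H(τ) / p(τ)}`. -/
def qdriftUnitary (H : ℝ → Matrix n n ℂ) (t τ : ℝ) : Matrix n n ℂ :=
  NormedSpace.exp ((-Complex.I / (qdriftDensity H t τ : ℂ)) • H τ)

/-- The matrix `e^{i H(τ) / p(τ)}`. -/
def qdriftUnitaryInv (H : ℝ → Matrix n n ℂ) (t τ : ℝ) : Matrix n n ℂ :=
  NormedSpace.exp ((Complex.I / (qdriftDensity H t τ : ℂ)) • H τ)

/-- The continuous qDRIFT channel: the mixture, with density `p` on `[0, t]`, of the channels
`ρ ↦ e^{-i H(τ)/p(τ)} ρ e^{i H(τ)/p(τ)}`, as an integral in the (finite-dimensional) space of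
linear maps on matrices. -/
def qdriftChannel (H : ℝ → Matrix n n ℂ) (t : ℝ) : Matrix n n ℂ →L[ℂ] Matrix n n ℂ :=
  ∫ τ in (0 : ℝ)..t, qdriftDensity H t τ •
    ContinuousLinearMap.mulLeftRight ℂ (Matrix n n ℂ)
      (qdriftUnitary H t τ) (qdriftUnitaryInv H t τ)

end Channels

end

/-! ### Trace norm by duality with the spectral norm. -/

section TraceNorm

variable {n : Type*} [Fintype n] [DecidableEq n]

/-! Let `K τ` be `-iH(τ) ⊗ 1` on the doubled space. Both channels, tensored with the identity, agree
to first order with `B ↦ B + ∫ [K, B]`, and each differs from it in trace norm by at most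
`2‖H‖_{∞,1}² ‖B‖₁`. The triangle inequality gives the constant 4.

For the ideal channel, `ρ = G B G†` satisfies `ρ' = [K, ρ]` with `G` unitary, so `‖ρ(τ) - B‖₁ ≤
2‖B‖₁ ∫₀^τ ‖K‖`. Inserting this once more gives `4‖B‖₁ ∫ ‖K(τ)‖ ∫₀^τ ‖K‖ = 2‖B‖₁ (∫‖K‖)²`; this is
`traceNorm_conj_sub_le`. For qDRIFT, the same lemma is applied to each sampled unitary, whose
generator `K/p` is constant. The weight `p` restores the first-order term exactly, and `‖H‖/p =
‖H‖_{∞,1}` makes the remainder bound independent of the sample (`traceNorm_qdrift_sub_le`).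

The evolution equation comes from integrating the Dyson series termwise
(`timeOrderedExp_eq_integral`). -/

theorem sqrt_mul_sqrt_conjTranspose_mul_self (C : Matrix n n ℂ) :
    CFC.sqrt (Cᴴ * C) * CFC.sqrt (Cᴴ * C) = Cᴴ * C :=
  CFC.sqrt_mul_sqrt_self _ (Matrix.nonneg_iff_posSemidef.mpr
    (Matrix.posSemidef_conjTranspose_mul_self C))

/-- Polar decomposition with a contraction in place of the partial isometry. -/
theorem exists_polar (C : Matrix n n ℂ) :
    ∃ W : Matrix n n ℂ, ‖W‖ ≤ 1 ∧ W * CFC.sqrt (Cᴴ * C) = C ∧ Wᴴ * C = CFC.sqrt (Cᴴ * C) := by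
  have hPP := sqrt_mul_sqrt_conjTranspose_mul_self C
  set P := CFC.sqrt (Cᴴ * C) with hP
  have hP0 : 0 ≤ P := CFC.sqrt_nonneg _
  have hsa : IsSelfAdjoint P := hP0.isSelfAdjoint
  have hco : ∀ f : ℝ → ℝ, ContinuousOn f (spectrum ℝ P) := fun f =>
    (Matrix.finite_real_spectrum (A := P)).continuousOn f
  -- Because `0⁻¹ = 0`, this is the pseudo-inverse of `P`, and `C * J` is the polar factor even when
  -- `C` is singular.
  set J : Matrix n n ℂ := cfc (fun x : ℝ => x⁻¹) P with hJ
  have hJsa : Jᴴ = J := (cfc_predicate (fun x : ℝ => x⁻¹) P : IsSelfAdjoint J)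
  have hid : cfc (fun x : ℝ => x) P = P := cfc_id' ℝ P
  have hJP : J * P = cfc (fun x : ℝ => x⁻¹ * x) P := by
    rw [cfc_mul _ _ P (hco _) (hco _), hid]
  have hPJ : P * J = cfc (fun x : ℝ => x * x⁻¹) P := by
    rw [cfc_mul _ _ P (hco _) (hco _), hid]
  have hcomm : P * J = J * P := by
    rw [hJP, hPJ]; congr 1; ext x; ring
  have hJPP : J * P * P = P := by
    rw [hJP]
    nth_rw 2 [← hid]
    rw [← cfc_mul _ _ P (hco _) (hco _)]
    conv_rhs => rw [← hid]
    congr 1; ext x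
    by_cases hx : x = 0 <;> simp [hx]
  have hPsa : Pᴴ = P := hsa
  refine ⟨C * J, ?_, ?_, ?_⟩
  · have h1 : (C * J)ᴴ * (C * J) = J * P := by
      rw [Matrix.conjTranspose_mul, hJsa]
      calc J * Cᴴ * (C * J) = J * (Cᴴ * C) * J := by simp only [mul_assoc]
        _ = J * P * P * J := by rw [← hPP]; simp only [mul_assoc]
        _ = J * P := by rw [hJPP, hcomm]
    have h2 : ‖J * P‖ ≤ 1 := by
      rw [hJP]
      refine norm_cfc_le zero_le_one fun x _ => ?_
      by_cases hx : x = 0 <;> simp [hx]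
    have h3 := Matrix.l2_opNorm_conjTranspose_mul_self (C * J)
    rw [h1] at h3
    nlinarith [norm_nonneg (C * J)]
  · rw [← sub_eq_zero, ← Matrix.conjTranspose_mul_self_eq_zero]
    have h1 : C * J * P - C = C * (J * P - 1) := by rw [mul_sub, mul_one, mul_assoc]
    rw [h1, Matrix.conjTranspose_mul]
    have h2 : Cᴴ * (C * (J * P - 1)) = 0 := by
      rw [← mul_assoc, ← hPP, mul_assoc, mul_sub, mul_one, ← mul_assoc P J P, hcomm, hJPP, sub_self,
        mul_zero]
    rw [mul_assoc, h2, mul_zero]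
  · rw [Matrix.conjTranspose_mul, hJsa, mul_assoc, ← hPP, ← mul_assoc, hJPP]

/-- With `S = √P` and `v i` its columns, the trace is `∑ ⟨v i, Y v i⟩` while `tr P = ∑ ‖v i‖²`;
Cauchy–Schwarz finishes. -/
theorem norm_trace_mul_le_of_nonneg (Y : Matrix n n ℂ) {P : Matrix n n ℂ} (hP : 0 ≤ P) :
    ‖(Y * P).trace‖ ≤ ‖Y‖ * P.trace.re := by
  set S := CFC.sqrt P
  have hSS : S * S = P := CFC.sqrt_mul_sqrt_self P hP
  have hS : Sᴴ = S := (CFC.sqrt_nonneg P).isSelfAdjoint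
  let v : n → EuclideanSpace ℂ n := fun i => WithLp.toLp 2 (fun j => S j i)
  have h1 : (Y * P).trace = ∑ i, inner ℂ (v i) (Matrix.toEuclideanCLM (𝕜 := ℂ) Y (v i)) := by
    rw [← hSS, ← mul_assoc, Matrix.trace_mul_comm]
    simp only [Matrix.trace, Matrix.diag]
    refine Finset.sum_congr rfl fun i _ => ?_
    rw [Matrix.mul_apply]
    simp only [v, PiLp.inner_apply, Matrix.toEuclideanCLM_toLp, RCLike.inner_apply]
    refine Finset.sum_congr rfl fun j _ => ?_
    rw [mul_comm]
    congr 1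
    nth_rw 1 [← hS]
    rfl
  have h2 : P.trace.re = ∑ i, ‖v i‖ ^ 2 := by
    rw [← hSS]
    simp only [Matrix.trace, Matrix.diag, Complex.re_sum]
    refine Finset.sum_congr rfl fun i _ => ?_
    rw [EuclideanSpace.norm_sq_eq, Matrix.mul_apply, Complex.re_sum]
    refine Finset.sum_congr rfl fun j _ => ?_
    nth_rw 1 [← hS]
    rw [Matrix.conjTranspose_apply, Complex.star_def, ← Complex.normSq_eq_conj_mul_self,
      Complex.ofReal_re, Complex.normSq_eq_norm_sq]
  rw [h1, h2, Finset.mul_sum]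
  refine (norm_sum_le _ _).trans (Finset.sum_le_sum fun i _ => ?_)
  refine (norm_inner_le_norm _ _).trans ?_
  have h3 : ‖Matrix.toEuclideanCLM (𝕜 := ℂ) Y (v i)‖ ≤ ‖Y‖ * ‖v i‖ :=
    (Matrix.toEuclideanCLM (𝕜 := ℂ) Y).le_opNorm (v i)
  nlinarith [norm_nonneg (v i)]

theorem norm_trace_mul_le (X C : Matrix n n ℂ) : ‖(X * C).trace‖ ≤ ‖X‖ * traceNorm C := by
  obtain ⟨W, hW, hWP, -⟩ := exists_polar C
  have h0 : 0 ≤ CFC.sqrt (Cᴴ * C) := CFC.sqrt_nonneg _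
  have h1 := norm_trace_mul_le_of_nonneg (X * W) h0
  rw [mul_assoc, hWP] at h1
  refine h1.trans (mul_le_mul_of_nonneg_right ?_ ?_)
  · exact (norm_mul_le X W).trans (mul_le_of_le_one_right (norm_nonneg _) hW)
  · exact (Complex.le_def.mp (Matrix.nonneg_iff_posSemidef.mp h0).trace_nonneg).1

theorem traceNorm_nonneg (C : Matrix n n ℂ) : 0 ≤ traceNorm C :=
  (Complex.le_def.mp (Matrix.nonneg_iff_posSemidef.mp (CFC.sqrt_nonneg _)).trace_nonneg).1

/-- The adjoint polar factor attains the supremum in the duality with the spectral norm. Together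
with `norm_trace_mul_le` this replaces square roots by linear functionals in the estimates below. -/
theorem traceNorm_le_of_forall {C : Matrix n n ℂ} {r : ℝ}
    (h : ∀ X : Matrix n n ℂ, ‖X‖ ≤ 1 → ‖(X * C).trace‖ ≤ r) : traceNorm C ≤ r := by
  obtain ⟨W, hW, -, hWC⟩ := exists_polar C
  have h1 := h Wᴴ (by rwa [Matrix.l2_opNorm_conjTranspose])
  rw [hWC] at h1
  exact (Complex.re_le_norm _).trans h1

theorem traceNorm_mul_le_left (A C : Matrix n n ℂ) : traceNorm (A * C) ≤ ‖A‖ * traceNorm C := by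
  refine traceNorm_le_of_forall fun X hX => ?_
  rw [← mul_assoc]
  refine (norm_trace_mul_le _ _).trans (mul_le_mul_of_nonneg_right ?_ (traceNorm_nonneg C))
  exact (norm_mul_le X A).trans (mul_le_of_le_one_left (norm_nonneg _) hX)

theorem traceNorm_mul_le_right (C A : Matrix n n ℂ) : traceNorm (C * A) ≤ ‖A‖ * traceNorm C := by
  refine traceNorm_le_of_forall fun X hX => ?_
  rw [← mul_assoc, Matrix.trace_mul_comm, ← mul_assoc]
  refine (norm_trace_mul_le _ _).trans (mul_le_mul_of_nonneg_right ?_ (traceNorm_nonneg C))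
  exact (norm_mul_le A X).trans (mul_le_of_le_one_right (norm_nonneg _) hX)

theorem traceNorm_sub_le (C D : Matrix n n ℂ) : traceNorm (C - D) ≤ traceNorm C + traceNorm D := by
  refine traceNorm_le_of_forall fun X hX => ?_
  rw [mul_sub, Matrix.trace_sub]
  refine (norm_sub_le _ _).trans (add_le_add ?_ ?_)
  · exact (norm_trace_mul_le _ _).trans (mul_le_of_le_one_left (traceNorm_nonneg _) hX)
  · exact (norm_trace_mul_le _ _).trans (mul_le_of_le_one_left (traceNorm_nonneg _) hX)

theorem traceNorm_smul_le (c : ℝ) (C : Matrix n n ℂ) : traceNorm (c • C) ≤ |c| * traceNorm C := by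
  refine traceNorm_le_of_forall fun X hX => ?_
  rw [Matrix.mul_smul, Matrix.trace_smul, norm_smul, Real.norm_eq_abs]
  exact mul_le_mul_of_nonneg_left
    ((norm_trace_mul_le _ _).trans (mul_le_of_le_one_left (traceNorm_nonneg _) hX)) (abs_nonneg c)

theorem traceNorm_mul_sub_mul_le (A C : Matrix n n ℂ) :
    traceNorm (A * C - C * A) ≤ 2 * ‖A‖ * traceNorm C := by
  linarith [traceNorm_sub_le (A * C) (C * A), traceNorm_mul_le_left A C, traceNorm_mul_le_right C A]

theorem traceNorm_integral_le {F : ℝ → Matrix n n ℂ} {g : ℝ → ℝ} {a b : ℝ} (hab : a ≤ b)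
    (hF : IntervalIntegrable F volume a b) (hg : IntervalIntegrable g volume a b)
    (h : ∀ τ ∈ Ioc a b, traceNorm (F τ) ≤ g τ) :
    traceNorm (∫ τ in a..b, F τ) ≤ ∫ τ in a..b, g τ := by
  -- A fixed test matrix turns the claim into a scalar bound, since `C ↦ tr (X C)` commutes with the
  -- integral.
  refine traceNorm_le_of_forall fun X hX => ?_
  let φ : Matrix n n ℂ →L[ℝ] ℂ := LinearMap.toContinuousLinearMap
    ((Matrix.traceLinearMap n ℝ ℂ).comp (LinearMap.mulLeft ℝ X))
  have hφ : ∀ C, φ C = (X * C).trace := fun C => rfl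
  rw [← hφ, ← φ.intervalIntegral_comp_comm hF]
  refine intervalIntegral.norm_integral_le_of_norm_le hab (.of_forall fun τ hτ => ?_) hg
  rw [hφ]
  exact ((norm_trace_mul_le _ _).trans (mul_le_of_le_one_left (traceNorm_nonneg _) hX)).trans
    (h τ hτ)

end TraceNorm

/-! ### Convergence of the Dyson series and its differential equation. -/

section Dyson

variable {n : Type*} [Fintype n] [DecidableEq n] {A : ℝ → Matrix n n ℂ} {a b : ℝ} {S : Set ℝ}

/-- The derivative of an indefinite integral at an interior point of continuity. -/
theorem hasDerivAt_integral_of_continuousAt {E : Type*} [NormedAddCommGroup E] [NormedSpace ℝ E]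
    [CompleteSpace E] {f : ℝ → E} {a b x : ℝ} (hf : IntervalIntegrable f volume a b)
    (hx : x ∈ Ioo a b) (hc : ContinuousAt f x) :
    HasDerivAt (fun u => ∫ y in a..u, f y) (f x) x := by
  have hab : a ≤ b := (hx.1.trans hx.2).le
  refine intervalIntegral.integral_hasDerivAt_right
    (hf.mono_set (uIcc_subset_uIcc_left ?_)) ?_ hc
  · rw [uIcc_of_le hab]; exact Ioo_subset_Icc_self hx
  · refine ⟨Ioc a b, Ioc_mem_nhds hx.1 hx.2, ?_⟩
    exact ((intervalIntegrable_iff_integrableOn_Ioc_of_le hab).mp hf).aestronglyMeasurable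

theorem continuousOn_integral_Icc {E : Type*} [NormedAddCommGroup E] [NormedSpace ℝ E]
    {f : ℝ → E} {a b : ℝ} (hab : a ≤ b) (hf : IntervalIntegrable f volume a b) :
    ContinuousOn (fun u => ∫ y in a..u, f y) (Icc a b) := by
  rw [← uIcc_of_le hab]
  exact intervalIntegral.continuousOn_primitive_interval'
    hf left_mem_uIcc

/-- `∫ f Fᵏ = Fᵏ⁺¹ / (k + 1)` for the indefinite integral `F` of `f`. -/
theorem integral_mul_integral_pow {f : ℝ → ℝ} (hab : a ≤ b)
    (hf : IntervalIntegrable f volume a b) (hS : S.Countable)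
    (hc : ∀ τ ∈ Ioo a b \ S, ContinuousAt f τ) (k : ℕ) :
    ∫ τ in a..b, f τ * (∫ σ in a..τ, f σ) ^ k = (∫ τ in a..b, f τ) ^ (k + 1) / (k + 1) := by
  have hF := continuousOn_integral_Icc hab hf
  -- The fundamental theorem tolerates the countable exceptional set because the primitive is
  -- continuous everywhere.
  have h := integral_eq_of_hasDerivAt_off_countable
    (fun τ => (∫ σ in a..τ, f σ) ^ (k + 1) / ((k : ℝ) + 1))
    (fun τ => f τ * (∫ σ in a..τ, f σ) ^ k) (a := a) (b := b) hS ?_ ?_ ?_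
  · rw [h]; simp
  · rw [uIcc_of_le hab]; exact (hF.pow _).div_const _
  · intro x hx
    rw [min_eq_left hab, max_eq_right hab] at hx
    refine (((hasDerivAt_integral_of_continuousAt hf hx.1 (hc x hx)).pow (k + 1)).div_const
      ((k : ℝ) + 1)).congr_deriv ?_
    have hk : (k : ℝ) + 1 ≠ 0 := by positivity
    rw [Nat.add_sub_cancel, Nat.cast_add, Nat.cast_one]
    field_simp
  · exact hf.mul_continuousOn (by rw [uIcc_of_le hab]; exact hF.pow k)

theorem IntervalIntegrable.mono_Icc {E : Type*} [NormedAddCommGroup E] {f : ℝ → E} {a b τ : ℝ}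
    (hf : IntervalIntegrable f volume a b) (hτ : τ ∈ Icc a b) :
    IntervalIntegrable f volume a τ :=
  hf.mono_set (uIcc_subset_uIcc_left (by rwa [uIcc_of_le (hτ.1.trans hτ.2)]))

theorem integral_norm_le_of_mem_Icc {E : Type*} [NormedAddCommGroup E] {f : ℝ → E} {a b τ : ℝ}
    (hf : IntervalIntegrable f volume a b) (hτ : τ ∈ Icc a b) :
    ∫ σ in a..τ, ‖f σ‖ ≤ ∫ σ in a..b, ‖f σ‖ :=
  intervalIntegral.integral_mono_interval le_rfl hτ.1 hτ.2
    (.of_forall fun _ => norm_nonneg _) hf.norm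

theorem integral_norm_nonneg_of_le {E : Type*} [NormedAddCommGroup E] {f : ℝ → E} {a τ : ℝ}
    (hτ : a ≤ τ) : 0 ≤ ∫ σ in a..τ, ‖f σ‖ :=
  intervalIntegral.integral_nonneg hτ fun _ _ => norm_nonneg _

theorem continuousOn_dysonTerm (hab : a ≤ b) (hA : IntervalIntegrable A volume a b) (k : ℕ) :
    ContinuousOn (dysonTerm A a k) (Icc a b) := by
  induction k with
  | zero => exact continuousOn_const
  | succ k ih =>
    exact continuousOn_integral_Icc hab (hA.mul_continuousOn (by rwa [uIcc_of_le hab]))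

/-- Keeping the upper limit `τ` in the bound lets the induction integrate it;
`integral_mul_integral_pow` supplies the next factor of the factorial. The factor `‖1‖` covers an
empty index type, where it is 0. -/
theorem norm_dysonTerm_le (hA : IntervalIntegrable A volume a b) (hS : S.Countable)
    (hc : ∀ τ ∈ Ioo a b \ S, ContinuousAt A τ) (k : ℕ) :
    ∀ τ ∈ Icc a b, ‖dysonTerm A a k τ‖ ≤
      ‖(1 : Matrix n n ℂ)‖ * ((∫ σ in a..τ, ‖A σ‖) ^ k / k.factorial) := by
  induction k with
  | zero => intro τ _; simp [dysonTerm]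
  | succ k ih =>
    intro τ hτ
    have hAτ := hA.mono_Icc hτ
    have hsub : Ioo a τ ⊆ Ioo a b := Ioo_subset_Ioo_right hτ.2
    have hval := integral_mul_integral_pow (f := fun σ => ‖A σ‖) hτ.1 hAτ.norm hS
      (fun x hx => (hc x ⟨hsub hx.1, hx.2⟩).norm) k
    have hcont : ContinuousOn (fun u => ∫ σ in a..u, ‖A σ‖) (Icc a τ) :=
      continuousOn_integral_Icc hτ.1 hAτ.norm
    have hle : ‖∫ σ in a..τ, A σ * dysonTerm A a k σ‖ ≤ ∫ σ in a..τ,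
        ‖(1 : Matrix n n ℂ)‖ / k.factorial * (‖A σ‖ * (∫ u in a..σ, ‖A u‖) ^ k) := by
      refine intervalIntegral.norm_integral_le_of_norm_le hτ.1 (.of_forall fun σ hσ => ?_) ?_
      · have h1 := ih σ ⟨hσ.1.le, hσ.2.trans hτ.2⟩
        calc _ ≤ ‖A σ‖ * ‖dysonTerm A a k σ‖ := norm_mul_le _ _
          _ ≤ ‖A σ‖ * _ := mul_le_mul_of_nonneg_left h1 (norm_nonneg _)
          _ = _ := by ring
      · exact (hAτ.norm.mul_continuousOn (by rw [uIcc_of_le hτ.1]; exact hcont.pow k)).const_mul _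
    rw [intervalIntegral.integral_const_mul, hval] at hle
    refine hle.trans_eq ?_
    rw [Nat.factorial_succ]
    push_cast
    field_simp

theorem norm_dysonTerm_le_const (hA : IntervalIntegrable A volume a b) (hS : S.Countable)
    (hc : ∀ τ ∈ Ioo a b \ S, ContinuousAt A τ) (k : ℕ) {τ : ℝ} (hτ : τ ∈ Icc a b) :
    ‖dysonTerm A a k τ‖ ≤
      ‖(1 : Matrix n n ℂ)‖ * ((∫ σ in a..b, ‖A σ‖) ^ k / k.factorial) := by
  refine (norm_dysonTerm_le hA hS hc k τ hτ).trans ?_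
  gcongr
  · exact integral_norm_nonneg_of_le hτ.1
  · exact integral_norm_le_of_mem_Icc hA hτ

theorem summable_dyson_bound (A : ℝ → Matrix n n ℂ) (a b : ℝ) :
    Summable fun k : ℕ =>
      ‖(1 : Matrix n n ℂ)‖ * ((∫ σ in a..b, ‖A σ‖) ^ k / k.factorial) :=
  (Real.summable_pow_div_factorial _).mul_left _

theorem summable_dysonTerm (hA : IntervalIntegrable A volume a b) (hS : S.Countable)
    (hc : ∀ τ ∈ Ioo a b \ S, ContinuousAt A τ) {τ : ℝ} (hτ : τ ∈ Icc a b) :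
    Summable fun k => dysonTerm A a k τ :=
  (summable_dyson_bound A a b).of_norm_bounded fun k => norm_dysonTerm_le_const hA hS hc k hτ

theorem continuousOn_timeOrderedExp (hab : a ≤ b) (hA : IntervalIntegrable A volume a b)
    (hS : S.Countable) (hc : ∀ τ ∈ Ioo a b \ S, ContinuousAt A τ) :
    ContinuousOn (timeOrderedExp A a) (Icc a b) :=
  continuousOn_tsum (continuousOn_dysonTerm hab hA) (summable_dyson_bound A a b)
    fun k _ hτ => norm_dysonTerm_le_const hA hS hc k hτ

/-- Dominated convergence permits termwise integration, which shifts the series by one index; the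
missing zeroth term is the `1`. -/
theorem timeOrderedExp_eq_integral (hA : IntervalIntegrable A volume a b)
    (hS : S.Countable) (hc : ∀ τ ∈ Ioo a b \ S, ContinuousAt A τ) {τ : ℝ} (hτ : τ ∈ Icc a b) :
    timeOrderedExp A a τ = 1 + ∫ σ in a..τ, A σ * timeOrderedExp A a σ := by
  have hab := hτ.1.trans hτ.2
  have hAτ := hA.mono_Icc hτ
  have hsub : ∀ σ ∈ uIoc a τ, σ ∈ Icc a b := fun σ hσ => by
    rw [uIoc_of_le hτ.1] at hσ
    exact ⟨hσ.1.le, hσ.2.trans hτ.2⟩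
  have h := intervalIntegral.hasSum_integral_of_dominated_convergence (μ := volume)
    (a := a) (b := τ)
    (F := fun k σ => A σ * dysonTerm A a k σ) (f := fun σ => A σ * timeOrderedExp A a σ)
    (fun k σ => ‖A σ‖ *
      (‖(1 : Matrix n n ℂ)‖ * ((∫ σ in a..b, ‖A σ‖) ^ k / k.factorial))) ?_ ?_ ?_ ?_ ?_
  · rw [timeOrderedExp, (summable_dysonTerm hA hS hc hτ).tsum_eq_zero_add, ← h.tsum_eq]
    rfl
  · intro k
    have hD : ContinuousOn (dysonTerm A a k) (uIcc a τ) := by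
      rw [uIcc_of_le hτ.1]
      exact (continuousOn_dysonTerm hab hA k).mono (Icc_subset_Icc_right hτ.2)
    exact (intervalIntegrable_iff.mp (hAτ.mul_continuousOn hD)).aestronglyMeasurable
  · refine fun k => .of_forall fun σ hσ => (norm_mul_le _ _).trans ?_
    exact mul_le_mul_of_nonneg_left (norm_dysonTerm_le_const hA hS hc k (hsub σ hσ))
      (norm_nonneg _)
  · exact .of_forall fun σ _ => (summable_dyson_bound A a b).mul_left _
  · simp only [tsum_mul_left]
    exact hAτ.norm.mul_const _
  · exact .of_forall fun σ hσ => (summable_dysonTerm hA hS hc (hsub σ hσ)).hasSum.mul_left _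

theorem timeOrderedExp_self (A : ℝ → Matrix n n ℂ) (a : ℝ) : timeOrderedExp A a a = 1 := by
  rw [timeOrderedExp, tsum_eq_single 0]
  · rfl
  · intro k hk
    obtain ⟨k, rfl⟩ := Nat.exists_eq_succ_of_ne_zero hk
    simp [dysonTerm]

theorem hasDerivAt_timeOrderedExp (hA : IntervalIntegrable A volume a b)
    (hS : S.Countable) (hc : ∀ τ ∈ Ioo a b \ S, ContinuousAt A τ) {τ : ℝ} (hτ : τ ∈ Ioo a b)
    (hAτ : ContinuousAt A τ) :
    HasDerivAt (timeOrderedExp A a) (A τ * timeOrderedExp A a τ) τ := by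
  have hab := (hτ.1.trans hτ.2).le
  have hE := continuousOn_timeOrderedExp hab hA hS hc
  have hnhds := Icc_mem_nhds hτ.1 hτ.2
  refine ((hasDerivAt_integral_of_continuousAt
    (hA.mul_continuousOn (by rwa [uIcc_of_le hab])) hτ
    (hAτ.mul (hE.continuousAt hnhds))).const_add 1).congr_of_eventuallyEq ?_
  filter_upwards [hnhds] with σ hσ
  exact timeOrderedExp_eq_integral hA hS hc hσ

end Dyson

/-! ### Second-order estimates for unitary conjugation. -/

section SecondOrder

variable {m : Type*} [Fintype m] [DecidableEq m] {K G : ℝ → Matrix m m ℂ} {a b : ℝ} {S : Set ℝ}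

theorem HasDerivAt.matrix_conjTranspose {f : ℝ → Matrix m m ℂ} {f' : Matrix m m ℂ} {x : ℝ}
    (hf : HasDerivAt f f' x) : HasDerivAt (fun y => (f y)ᴴ) f'ᴴ x := by
  simpa only [Matrix.star_eq_conjTranspose] using hf.star

theorem norm_le_one_of_conjTranspose_mul_self {U : Matrix m m ℂ} (h : Uᴴ * U = 1) :
    ‖U‖ ≤ 1 := by
  have h1 := Matrix.l2_opNorm_conjTranspose_mul_self U
  have h2 := Matrix.l2_opNorm_conjTranspose_mul_self (1 : Matrix m m ℂ)
  rw [Matrix.conjTranspose_one, one_mul] at h2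
  rw [h] at h1
  have h3 : ‖(1 : Matrix m m ℂ)‖ ≤ 1 := by nlinarith [norm_nonneg (1 : Matrix m m ℂ)]
  nlinarith [norm_nonneg U]

/-- A solution of `G' = K G` with `K` skew-Hermitian stays unitary. -/
theorem conjTranspose_mul_self_of_hasDerivAt (hab : a ≤ b) (hS : S.Countable)
    (hskew : ∀ τ ∈ Ioo a b, (K τ)ᴴ = -K τ) (hG : ContinuousOn G (Icc a b)) (hG0 : G a = 1)
    (hd : ∀ τ ∈ Ioo a b \ S, HasDerivAt G (K τ * G τ) τ) : (G b)ᴴ * G b = 1 := by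
  have h := integral_eq_of_hasDerivAt_off_countable (fun τ => (G τ)ᴴ * G τ)
    (fun _ => (0 : Matrix m m ℂ)) (a := a) (b := b) hS ?_ ?_ (by simp)
  · rw [intervalIntegral.integral_zero, hG0] at h
    simpa using (sub_eq_zero.mp h.symm)
  · rw [uIcc_of_le hab]; exact (continuous_star.comp_continuousOn hG).mul hG
  · intro x hx
    rw [min_eq_left hab, max_eq_right hab] at hx
    refine ((hd x hx).matrix_conjTranspose.mul (hd x hx)).congr_deriv ?_
    rw [Matrix.conjTranspose_mul, hskew x hx.1]
    simp [mul_assoc]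

/-- Integrated von Neumann equation: skewness of `K` turns the product rule into a commutator. -/
theorem conj_sub_eq_integral (hab : a ≤ b) (hS : S.Countable)
    (hskew : ∀ τ ∈ Ioo a b, (K τ)ᴴ = -K τ) (hK : IntervalIntegrable K volume a b)
    (hG : ContinuousOn G (Icc a b)) (hG0 : G a = 1)
    (hd : ∀ τ ∈ Ioo a b \ S, HasDerivAt G (K τ * G τ) τ) (B : Matrix m m ℂ) :
    G b * B * (G b)ᴴ - B =
      ∫ τ in a..b, (K τ * (G τ * B * (G τ)ᴴ) - G τ * B * (G τ)ᴴ * K τ) := by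
  have hρ : ContinuousOn (fun τ => G τ * B * (G τ)ᴴ) (uIcc a b) := by
    rw [uIcc_of_le hab]
    exact (hG.mul continuousOn_const).mul (continuous_star.comp_continuousOn hG)
  rw [integral_eq_of_hasDerivAt_off_countable (fun τ => G τ * B * (G τ)ᴴ) _ hS hρ ?_
    ((hK.mul_continuousOn hρ).sub (hK.continuousOn_mul hρ))]
  · simp [hG0]
  · intro x hx
    rw [min_eq_left hab, max_eq_right hab] at hx
    refine (((hd x hx).mul_const B).mul (hd x hx).matrix_conjTranspose).congr_deriv ?_
    rw [Matrix.conjTranspose_mul, hskew x hx.1]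
    simp [mul_assoc, sub_eq_add_neg]

/-- Second-order expansion of a unitary evolution in the trace norm. -/
theorem traceNorm_conj_sub_le (hab : a ≤ b) (hS : S.Countable)
    (hskew : ∀ τ ∈ Icc a b, (K τ)ᴴ = -K τ) (hK : IntervalIntegrable K volume a b)
    (hKc : ∀ τ ∈ Ioo a b \ S, ContinuousAt K τ)
    (hG : ContinuousOn G (Icc a b)) (hG0 : G a = 1)
    (hd : ∀ τ ∈ Ioo a b \ S, HasDerivAt G (K τ * G τ) τ) (B : Matrix m m ℂ) :
    traceNorm (G b * B * (G b)ᴴ - B - ∫ τ in a..b, (K τ * B - B * K τ)) ≤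
      2 * (∫ τ in a..b, ‖K τ‖) ^ 2 * traceNorm B := by
  have hρ : ContinuousOn (fun τ => G τ * B * (G τ)ᴴ) (Icc a b) :=
    (hG.mul continuousOn_const).mul (continuous_star.comp_continuousOn hG)
  have hrest : ∀ τ ∈ Icc a b, ContinuousOn G (Icc a τ) ∧
      (∀ σ ∈ Ioo a τ, (K σ)ᴴ = -K σ) ∧ ∀ σ ∈ Ioo a τ \ S, HasDerivAt G (K σ * G σ) σ :=
    fun τ hτ => ⟨hG.mono (Icc_subset_Icc_right hτ.2),
      fun σ hσ => hskew σ ⟨hσ.1.le, hσ.2.le.trans hτ.2⟩,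
      fun σ hσ => hd σ ⟨Ioo_subset_Ioo_right hτ.2 hσ.1, hσ.2⟩⟩
  have hB := traceNorm_nonneg B
  have hnorm : ∀ τ ∈ Icc a b, traceNorm (G τ * B * (G τ)ᴴ) ≤ traceNorm B := fun τ hτ => by
    obtain ⟨h1, h2, h3⟩ := hrest τ hτ
    have hU := norm_le_one_of_conjTranspose_mul_self
      (conjTranspose_mul_self_of_hasDerivAt hτ.1 hS h2 h1 hG0 h3)
    refine (traceNorm_mul_le_right _ _).trans ?_
    rw [Matrix.l2_opNorm_conjTranspose]
    refine (mul_le_of_le_one_left (traceNorm_nonneg _) hU).trans ?_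
    exact (traceNorm_mul_le_left _ _).trans (mul_le_of_le_one_left hB hU)
  have hfirst : ∀ τ ∈ Icc a b, traceNorm (G τ * B * (G τ)ᴴ - B) ≤
      2 * traceNorm B * ∫ σ in a..τ, ‖K σ‖ := fun τ hτ => by
    obtain ⟨h1, h2, h3⟩ := hrest τ hτ
    have hKτ := hK.mono_Icc hτ
    have hρτ : ContinuousOn (fun τ => G τ * B * (G τ)ᴴ) (uIcc a τ) := by
      rw [uIcc_of_le hτ.1]; exact hρ.mono (Icc_subset_Icc_right hτ.2)
    rw [conj_sub_eq_integral hτ.1 hS h2 hKτ h1 hG0 h3 B, ← intervalIntegral.integral_const_mul]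
    refine traceNorm_integral_le hτ.1
      ((hKτ.mul_continuousOn hρτ).sub (hKτ.continuousOn_mul hρτ)) (hKτ.norm.const_mul _) ?_
    intro σ hσ
    refine (traceNorm_mul_sub_mul_le _ _).trans ?_
    have := hnorm σ ⟨hσ.1.le, hσ.2.trans hτ.2⟩
    nlinarith [norm_nonneg (K σ)]
  have hρ' : ContinuousOn (fun τ => G τ * B * (G τ)ᴴ) (uIcc a b) := by rwa [uIcc_of_le hab]
  have hρB : ContinuousOn (fun τ => G τ * B * (G τ)ᴴ - B) (uIcc a b) :=
    hρ'.sub continuousOn_const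
  obtain ⟨h1, h2, h3⟩ := hrest b (right_mem_Icc.mpr hab)
  rw [conj_sub_eq_integral hab hS h2 hK h1 hG0 h3 B, ← intervalIntegral.integral_sub
    ((hK.mul_continuousOn hρ').sub (hK.continuousOn_mul hρ'))
    ((hK.mul_const B).sub (hK.const_mul B))]
  -- Exponent 1 gives half the square, so the two commutator factors `2 * 2` become 2.
  have hval := integral_mul_integral_pow (f := fun σ => ‖K σ‖) hab hK.norm hS
    (fun x hx => (hKc x hx).norm) 1
  have hfin : 2 * (∫ τ in a..b, ‖K τ‖) ^ 2 * traceNorm B =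
      ∫ τ in a..b, 4 * traceNorm B * (‖K τ‖ * (∫ σ in a..τ, ‖K σ‖) ^ 1) := by
    rw [intervalIntegral.integral_const_mul, hval]; push_cast; ring
  rw [hfin]
  -- Subtracting the first-order term leaves the commutator with `ρ - B`, to which `hfirst` applies.
  have heq : ∀ τ, K τ * (G τ * B * (G τ)ᴴ) - G τ * B * (G τ)ᴴ * K τ - (K τ * B - B * K τ) =
      K τ * (G τ * B * (G τ)ᴴ - B) - (G τ * B * (G τ)ᴴ - B) * K τ := fun τ => by
    noncomm_ring
  simp only [heq]
  refine traceNorm_integral_le hab ((hK.mul_continuousOn hρB).sub (hK.continuousOn_mul hρB)) ?_ ?_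
  · refine (hK.norm.mul_continuousOn ?_).const_mul _
    rw [uIcc_of_le hab]
    exact (continuousOn_integral_Icc hab hK.norm).pow 1
  · intro τ hτ
    refine (traceNorm_mul_sub_mul_le _ _).trans ?_
    have := hfirst τ ⟨hτ.1.le, hτ.2⟩
    nlinarith [norm_nonneg (K τ)]

theorem exp_conjTranspose_of_skew {A : Matrix m m ℂ} (hA : Aᴴ = -A) :
    (NormedSpace.exp A)ᴴ = NormedSpace.exp (-A) := by
  rw [← Matrix.exp_conjTranspose, hA]

theorem exp_mul_exp_neg_eq_one (A : Matrix m m ℂ) :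
    NormedSpace.exp A * NormedSpace.exp (-A) = 1 := by
  rw [← Matrix.exp_add_of_commute _ _ (Commute.neg_right (Commute.refl A)), add_neg_cancel,
    NormedSpace.exp_zero]

theorem norm_exp_le_one_of_skew {A : Matrix m m ℂ} (hA : Aᴴ = -A) : ‖NormedSpace.exp A‖ ≤ 1 := by
  refine norm_le_one_of_conjTranspose_mul_self ?_
  have := exp_mul_exp_neg_eq_one (-A)
  rwa [neg_neg, ← exp_conjTranspose_of_skew hA] at this

/-- The constant-generator case on `[0, 1]`, with `G s = exp (s • A)`. -/
theorem traceNorm_exp_conj_sub_le {A : Matrix m m ℂ} (hA : Aᴴ = -A) (B : Matrix m m ℂ) :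
    traceNorm (NormedSpace.exp A * B * NormedSpace.exp (-A) - B - (A * B - B * A)) ≤
      2 * ‖A‖ ^ 2 * traceNorm B := by
  have hd : ∀ s : ℝ, HasDerivAt (fun s : ℝ => NormedSpace.exp (s • A))
      (A * NormedSpace.exp (s • A)) s := fun s => hasDerivAt_exp_smul_const' A s
  have h := traceNorm_conj_sub_le (K := fun _ => A) (G := fun s : ℝ => NormedSpace.exp (s • A))
    (zero_le_one (α := ℝ)) countable_empty (fun _ _ => hA) (by simp)
    (fun _ _ => continuousAt_const) (fun s _ => (hd s).continuousAt.continuousWithinAt)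
    (by simp) (fun s _ => hd s) B
  simpa [exp_conjTranspose_of_skew hA] using h

end SecondOrder

/-! ### Integrability and measurability under linear maps. -/

section Auxiliary

variable {𝕜 E F : Type*} [RCLike 𝕜] [NormedAddCommGroup E] [NormedSpace 𝕜 E]
  [NormedAddCommGroup F] [NormedSpace 𝕜 F]

theorem IntervalIntegrable.clm_comp (L : E →L[𝕜] F) {f : ℝ → E} {a b : ℝ}
    (hf : IntervalIntegrable f volume a b) :
    IntervalIntegrable (fun x => L (f x)) volume a b := by
  rw [intervalIntegrable_iff] at hf ⊢
  exact L.integrable_comp hf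

theorem continuous_mulLeftRight {R : Type*} [NormedRing R] [NormedAlgebra ℂ R] :
    Continuous fun p : R × R => ContinuousLinearMap.mulLeftRight ℂ R p.1 p.2 :=
  (ContinuousLinearMap.mulLeftRight ℂ R).continuous₂

theorem MeasureTheory.AEStronglyMeasurable.mulLeftRight {R α : Type*} [NormedRing R]
    [NormedAlgebra ℂ R] [MeasurableSpace α] {μ : Measure α} {f g : α → R}
    (hf : AEStronglyMeasurable f μ) (hg : AEStronglyMeasurable g μ) :
    AEStronglyMeasurable (fun x => ContinuousLinearMap.mulLeftRight ℂ R (f x) (g x)) μ := by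
  have h := Continuous.comp_aestronglyMeasurable
    (g := fun p : R × R => ContinuousLinearMap.mulLeftRight ℂ R p.1 p.2)
    (f := fun x => (f x, g x)) continuous_mulLeftRight (hf.prodMk hg)
  exact h

end Auxiliary

/-! ### Passage to the doubled space. -/

section Ancilla

variable {n : Type*} [Fintype n] [DecidableEq n]

/-- The embedding `A ↦ A ⊗ 1` of matrices into matrices over the tensor square. -/
noncomputable def tensorOne : Matrix n n ℂ →⋆ₐ[ℂ] Matrix (n × n) (n × n) ℂ where
  toFun A := Matrix.kroneckerMap (· * ·) A 1
  map_one' := Matrix.one_kronecker_one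
  map_mul' A B := by rw [← Matrix.mul_kronecker_mul, one_mul]
  map_zero' := Matrix.zero_kronecker _
  map_add' A B := Matrix.add_kronecker _ _ _
  commutes' r := by
    simp only [Algebra.algebraMap_eq_smul_one]
    rw [Matrix.smul_kronecker, Matrix.one_kronecker_one]
  map_star' A := by
    simp only [Matrix.star_eq_conjTranspose]
    rw [Matrix.conjTranspose_kronecker, Matrix.conjTranspose_one]

theorem tensorOne_apply (A : Matrix n n ℂ) (x y : n × n) :
    tensorOne A x y = A x.1 y.1 * (1 : Matrix n n ℂ) x.2 y.2 := rfl

/-- Star homomorphisms of C⋆-algebras are contractive. -/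
theorem norm_tensorOne_le (A : Matrix n n ℂ) : ‖tensorOne A‖ ≤ ‖A‖ :=
  NonUnitalStarAlgHom.norm_apply_le tensorOne A

theorem tensorOne_conjTranspose (A : Matrix n n ℂ) : tensorOne Aᴴ = (tensorOne A)ᴴ :=
  map_star tensorOne A

/-- `tensorOne` as a real continuous linear map. -/
noncomputable def tensorOneCLM : Matrix n n ℂ →L[ℝ] Matrix (n × n) (n × n) ℂ :=
  LinearMap.mkContinuous
    ((tensorOne (n := n)).toAlgHom.toLinearMap.restrictScalars ℝ) 1
    fun A => by simpa using norm_tensorOne_le A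

theorem tensorOneCLM_apply (A : Matrix n n ℂ) : tensorOneCLM A = tensorOne A := rfl

theorem tensorOne_exp (A : Matrix n n ℂ) :
    tensorOne (NormedSpace.exp A) = NormedSpace.exp (tensorOne A) := by
  let : NormedAlgebra ℚ (Matrix n n ℂ) := .restrictScalars ℚ ℂ _
  exact NormedSpace.map_exp tensorOne tensorOneCLM.continuous A

theorem tensorId_mulLeftRight (U V : Matrix n n ℂ) (B : Matrix (n × n) (n × n) ℂ) :
    tensorId (ContinuousLinearMap.mulLeftRight ℂ (Matrix n n ℂ) U V :
      Matrix n n ℂ →ₗ[ℂ] Matrix n n ℂ) B = tensorOne U * B * tensorOne V := by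
  ext ⟨i, a⟩ ⟨j, b⟩
  simp [tensorId, Matrix.mul_apply, Fintype.sum_prod_type, tensorOne_apply, Matrix.one_apply,
    ContinuousLinearMap.mulLeftRight_apply]

end Ancilla

section TensorId

variable {n : Type*} [Fintype n]

/-- `Φ ↦ (Φ ⊗ id) B` as a continuous linear map. -/
noncomputable def tensorIdCLM (B : Matrix (n × n) (n × n) ℂ) :
    (Matrix n n ℂ →L[ℂ] Matrix n n ℂ) →L[ℂ] Matrix (n × n) (n × n) ℂ :=
  LinearMap.toContinuousLinearMap
    { toFun := fun Φ => tensorId (Φ : Matrix n n ℂ →ₗ[ℂ] Matrix n n ℂ) B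
      map_add' := fun _ _ => rfl
      map_smul' := fun _ _ => rfl }

theorem tensorIdCLM_apply (B : Matrix (n × n) (n × n) ℂ)
    (Φ : Matrix n n ℂ →L[ℂ] Matrix n n ℂ) :
    tensorIdCLM B Φ = tensorId (Φ : Matrix n n ℂ →ₗ[ℂ] Matrix n n ℂ) B := rfl

end TensorId

theorem conjTranspose_neg_I_smul {n : Type*} {A : Matrix n n ℂ} (hA : A.IsHermitian) :
    (-Complex.I • A)ᴴ = -(-Complex.I • A) := by
  rw [Matrix.conjTranspose_smul, hA.eq]
  simp

/-! ### The qDRIFT channel and its expansion. -/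

section QDrift

variable {n : Type*} [Fintype n] [DecidableEq n] {H : ℝ → Matrix n n ℂ} {t : ℝ}

theorem normInftyOne_pos (ht : 0 < t) (hne : ∀ τ ∈ Icc (0 : ℝ) t, H τ ≠ 0)
    (hint : IntervalIntegrable H volume 0 t) : 0 < normInftyOne H t :=
  intervalIntegral.intervalIntegral_pos_of_pos_on hint.norm
    (fun τ hτ => norm_pos_iff.mpr (hne τ (Ioo_subset_Icc_self hτ))) ht

theorem intervalIntegrable_qdriftDensity (hint : IntervalIntegrable H volume 0 t) :
    IntervalIntegrable (qdriftDensity H t) volume 0 t :=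
  hint.norm.div_const _

theorem integral_qdriftDensity (h : normInftyOne H t ≠ 0) :
    ∫ τ in (0 : ℝ)..t, qdriftDensity H t τ = 1 := by
  simp only [qdriftDensity]
  rw [intervalIntegral.integral_div]
  exact div_self h

theorem qdriftUnitary_eq_exp (H : ℝ → Matrix n n ℂ) (t τ : ℝ) :
    qdriftUnitary H t τ =
      NormedSpace.exp ((qdriftDensity H t τ)⁻¹ • (-Complex.I • H τ)) := by
  rw [qdriftUnitary, ← Complex.coe_smul, smul_smul, Complex.ofReal_inv, div_eq_inv_mul]

theorem qdriftUnitaryInv_eq_exp (H : ℝ → Matrix n n ℂ) (t τ : ℝ) :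
    qdriftUnitaryInv H t τ =
      NormedSpace.exp (-((qdriftDensity H t τ)⁻¹ • (-Complex.I • H τ))) := by
  rw [qdriftUnitaryInv, ← Complex.coe_smul, smul_smul, Complex.ofReal_inv, div_eq_inv_mul,
    ← neg_smul, mul_neg, neg_neg]

theorem norm_qdriftUnitary_le {τ : ℝ} (hH : (H τ).IsHermitian) : ‖qdriftUnitary H t τ‖ ≤ 1 := by
  rw [qdriftUnitary_eq_exp]
  refine norm_exp_le_one_of_skew ?_
  rw [Matrix.conjTranspose_smul, conjTranspose_neg_I_smul hH, star_trivial, smul_neg]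

theorem norm_qdriftUnitaryInv_le {τ : ℝ} (hH : (H τ).IsHermitian) :
    ‖qdriftUnitaryInv H t τ‖ ≤ 1 := by
  rw [qdriftUnitaryInv_eq_exp]
  refine norm_exp_le_one_of_skew ?_
  rw [Matrix.conjTranspose_neg, Matrix.conjTranspose_smul, conjTranspose_neg_I_smul hH,
    star_trivial, smul_neg]

theorem aestronglyMeasurable_exp_smul (z : ℂ) (hint : IntervalIntegrable H volume 0 t) :
    AEStronglyMeasurable
      (fun τ => NormedSpace.exp ((z / (qdriftDensity H t τ : ℂ)) • H τ))
      (volume.restrict (uIoc 0 t)) := by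
  let : NormedAlgebra ℚ (Matrix n n ℂ) := .restrictScalars ℚ ℂ _
  have hp := (intervalIntegrable_iff.mp
    (intervalIntegrable_qdriftDensity hint)).aestronglyMeasurable.aemeasurable
  have hz : AEStronglyMeasurable (fun τ => z / (qdriftDensity H t τ : ℂ))
      (volume.restrict (uIoc 0 t)) :=
    (hp.complex_ofReal.const_div z).aestronglyMeasurable
  exact (NormedSpace.exp_continuous (𝔸 := Matrix n n ℂ)).comp_aestronglyMeasurable
    (hz.smul (intervalIntegrable_iff.mp hint).aestronglyMeasurable)

/-- The integrand of the qDRIFT channel is integrable. -/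
theorem intervalIntegrable_qdrift (ht : 0 ≤ t)
    (hherm : ∀ τ ∈ Icc (0 : ℝ) t, (H τ).IsHermitian)
    (hint : IntervalIntegrable H volume 0 t) :
    IntervalIntegrable (fun τ => qdriftDensity H t τ •
      ContinuousLinearMap.mulLeftRight ℂ (Matrix n n ℂ)
        (qdriftUnitary H t τ) (qdriftUnitaryInv H t τ)) volume 0 t := by
  have hU : AEStronglyMeasurable (qdriftUnitary H t) (volume.restrict (uIoc 0 t)) :=
    aestronglyMeasurable_exp_smul (-Complex.I) hint
  have hV : AEStronglyMeasurable (qdriftUnitaryInv H t) (volume.restrict (uIoc 0 t)) :=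
    aestronglyMeasurable_exp_smul Complex.I hint
  rw [intervalIntegrable_iff]
  refine (intervalIntegrable_iff.mp (intervalIntegrable_qdriftDensity hint)).smul_bdd 1 ?_ ?_
  -- The exponentials are contractions, so the integrand is dominated by the density `p`.
  · exact hU.mulLeftRight hV
  · refine (ae_restrict_mem measurableSet_uIoc).mono fun τ hτ => ?_
    rw [uIoc_of_le ht] at hτ
    have hH := hherm τ (Ioc_subset_Icc_self hτ)
    refine (ContinuousLinearMap.opNorm_mulLeftRight_apply_apply_le ℂ _ _ _).trans ?_
    exact mul_le_one₀ (norm_qdriftUnitary_le hH) (norm_nonneg _) (norm_qdriftUnitaryInv_le hH)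

theorem tensorId_qdriftChannel (ht : 0 ≤ t)
    (hherm : ∀ τ ∈ Icc (0 : ℝ) t, (H τ).IsHermitian)
    (hint : IntervalIntegrable H volume 0 t) (B : Matrix (n × n) (n × n) ℂ) :
    IntervalIntegrable (fun τ => qdriftDensity H t τ •
      (tensorOne (qdriftUnitary H t τ) * B * tensorOne (qdriftUnitaryInv H t τ))) volume 0 t ∧
    tensorId (qdriftChannel H t : Matrix n n ℂ →ₗ[ℂ] Matrix n n ℂ) B =
      ∫ τ in (0 : ℝ)..t, qdriftDensity H t τ •
        (tensorOne (qdriftUnitary H t τ) * B * tensorOne (qdriftUnitaryInv H t τ)) := by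
  have h := intervalIntegrable_qdrift ht hherm hint
  have heq : ∀ τ, tensorIdCLM B (qdriftDensity H t τ •
      ContinuousLinearMap.mulLeftRight ℂ (Matrix n n ℂ)
        (qdriftUnitary H t τ) (qdriftUnitaryInv H t τ)) = qdriftDensity H t τ •
      (tensorOne (qdriftUnitary H t τ) * B * tensorOne (qdriftUnitaryInv H t τ)) := fun τ => by
    rw [ContinuousLinearMap.map_smul_of_tower, tensorIdCLM_apply, tensorId_mulLeftRight]
  constructor
  · have h1 : IntervalIntegrable (fun τ => tensorIdCLM B (qdriftDensity H t τ •
      ContinuousLinearMap.mulLeftRight ℂ (Matrix n n ℂ)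
        (qdriftUnitary H t τ) (qdriftUnitaryInv H t τ))) volume 0 t :=
      h.clm_comp (tensorIdCLM B)
    simpa only [heq] using h1
  · rw [← tensorIdCLM_apply, qdriftChannel, ← ContinuousLinearMap.intervalIntegral_comp_comm _ h]
    simp only [heq]

/-- Second-order expansion of the qDRIFT channel in the trace norm. -/
theorem traceNorm_qdrift_sub_le (ht : 0 < t)
    (hherm : ∀ τ ∈ Icc (0 : ℝ) t, (H τ).IsHermitian) (hne : ∀ τ ∈ Icc (0 : ℝ) t, H τ ≠ 0)
    (hint : IntervalIntegrable H volume 0 t) (B : Matrix (n × n) (n × n) ℂ) :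
    traceNorm (tensorId (qdriftChannel H t : Matrix n n ℂ →ₗ[ℂ] Matrix n n ℂ) B - B -
      ∫ τ in (0 : ℝ)..t, (tensorOne (-Complex.I • H τ) * B - B * tensorOne (-Complex.I • H τ))) ≤
      2 * normInftyOne H t ^ 2 * traceNorm B := by
  have hpos := normInftyOne_pos ht hne hint
  obtain ⟨h1, h2⟩ := tensorId_qdriftChannel ht.le hherm hint B
  have hp := intervalIntegrable_qdriftDensity hint
  have hK : IntervalIntegrable (fun τ => tensorOne (-Complex.I • H τ)) volume 0 t :=
    (hint.smul (-Complex.I)).clm_comp tensorOneCLM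
  have hpB : IntervalIntegrable (fun τ => qdriftDensity H t τ • B) volume 0 t := by
    rw [intervalIntegrable_iff] at hp ⊢
    exact hp.smul_const B
  -- As `p` has mass 1, `B` is its own average, so all three terms fit under one integral.
  have hB : B = ∫ τ in (0 : ℝ)..t, qdriftDensity H t τ • B := by
    rw [intervalIntegral.integral_smul_const, integral_qdriftDensity hpos.ne', one_smul]
  have hcomm := (hK.mul_const B).sub (hK.const_mul B)
  rw [h2]
  nth_rw 2 [hB]
  rw [← intervalIntegral.integral_sub h1 hpB, ← intervalIntegral.integral_sub (h1.sub hpB) hcomm]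
  have hbd : 2 * normInftyOne H t ^ 2 * traceNorm B =
      ∫ τ in (0 : ℝ)..t, qdriftDensity H t τ * (2 * normInftyOne H t ^ 2 * traceNorm B) := by
    rw [intervalIntegral.integral_mul_const, integral_qdriftDensity hpos.ne', one_mul]
  rw [hbd]
  refine traceNorm_integral_le ht.le ((h1.sub hpB).sub hcomm) (hp.mul_const _) fun τ hτ => ?_
  have hτ' := Ioc_subset_Icc_self hτ
  have hHpos : 0 < ‖H τ‖ := norm_pos_iff.mpr (hne τ hτ')
  have hppos : 0 < qdriftDensity H t τ := div_pos hHpos hpos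
  set p := qdriftDensity H t τ with hpdef
  set A : Matrix (n × n) (n × n) ℂ := tensorOne (p⁻¹ • (-Complex.I • H τ)) with hA
  -- Weighting by `p` undoes the rescaling of the generator: the first-order terms match pointwise.
  have hAK : p • A = tensorOne (-Complex.I • H τ) := by
    rw [hA, ← tensorOneCLM_apply, ← map_smul, smul_smul, mul_inv_cancel₀ hppos.ne', one_smul,
      tensorOneCLM_apply]
  have hskew : Aᴴ = -A := by
    rw [hA, ← tensorOne_conjTranspose, Matrix.conjTranspose_smul,
      conjTranspose_neg_I_smul (hherm τ hτ'), star_trivial, smul_neg, map_neg]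
  have hnorm : ‖A‖ ≤ normInftyOne H t := by
    refine (norm_tensorOne_le _).trans_eq ?_
    rw [norm_smul, norm_smul, norm_neg, Complex.norm_I, one_mul, Real.norm_eq_abs,
      abs_of_pos (inv_pos.mpr hppos), hpdef, qdriftDensity]
    field_simp
  have heq : p • (tensorOne (qdriftUnitary H t τ) * B * tensorOne (qdriftUnitaryInv H t τ)) -
      p • B - (tensorOne (-Complex.I • H τ) * B - B * tensorOne (-Complex.I • H τ)) =
      p • (NormedSpace.exp A * B * NormedSpace.exp (-A) - B - (A * B - B * A)) := by
    rw [qdriftUnitary_eq_exp, qdriftUnitaryInv_eq_exp, tensorOne_exp, tensorOne_exp, map_neg,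
      ← hA, ← hAK, smul_sub, smul_sub, smul_sub, Matrix.smul_mul, Matrix.mul_smul]
  rw [heq]
  refine (traceNorm_smul_le _ _).trans ?_
  rw [abs_of_pos hppos]
  refine mul_le_mul_of_nonneg_left ((traceNorm_exp_conj_sub_le hskew B).trans ?_) hppos.le
  have := traceNorm_nonneg B
  gcongr

end QDrift

theorem mainTheorem3 {n : Type*} [Fintype n] [DecidableEq n]
    (H : ℝ → Matrix n n ℂ) (t : ℝ) (ht : 0 < t)
    (hherm : ∀ τ ∈ Icc (0 : ℝ) t, (H τ).IsHermitian)
    (hne : ∀ τ ∈ Icc (0 : ℝ) t, H τ ≠ 0)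
    (hcont : ∃ S : Set ℝ, S.Finite ∧
      ∀ τ ∈ Icc (0 : ℝ) t \ S, ContinuousWithinAt H (Icc (0 : ℝ) t) τ)
    (hint : IntervalIntegrable H volume 0 t) :
    -- the time-ordered exponential is the solution of the Schrödinger equation
    (evolution H 0 = 1 ∧ ContinuousOn (evolution H) (Icc (0 : ℝ) t) ∧
      ∀ τ ∈ Ioo (0 : ℝ) t, ContinuousAt H τ →
        HasDerivAt (evolution H) (-Complex.I • H τ * evolution H τ) τ) ∧
    -- the qDRIFT channel is given by the (convergent) integral that defines it
    (∀ ρ : Matrix n n ℂ,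
      IntervalIntegrable (fun τ => qdriftDensity H t τ •
        (qdriftUnitary H t τ * ρ * qdriftUnitaryInv H t τ)) volume 0 t ∧
      qdriftChannel H t ρ = ∫ τ in (0 : ℝ)..t, qdriftDensity H t τ •
        (qdriftUnitary H t τ * ρ * qdriftUnitaryInv H t τ)) ∧
    -- the error bound
    diamondNorm ((idealChannel H t - qdriftChannel H t : Matrix n n ℂ →L[ℂ] Matrix n n ℂ) :
        Matrix n n ℂ →ₗ[ℂ] Matrix n n ℂ)
      ≤ 4 * normInftyOne H t ^ 2 := by
  obtain ⟨S, hSfin, hSc⟩ := hcont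
  have hS := hSfin.countable
  have hHc : ∀ τ ∈ Ioo 0 t \ S, ContinuousAt H τ := fun τ hτ =>
    (hSc τ ⟨Ioo_subset_Icc_self hτ.1, hτ.2⟩).continuousAt (Icc_mem_nhds hτ.1.1 hτ.1.2)
  have hA : IntervalIntegrable (fun σ => -Complex.I • H σ) volume 0 t := hint.smul (-Complex.I)
  have hAc : ∀ τ ∈ Ioo 0 t \ S, ContinuousAt (fun σ => -Complex.I • H σ) τ := fun τ hτ =>
    (hHc τ hτ).const_smul (-Complex.I)
  have hE0 : evolution H 0 = 1 := timeOrderedExp_self _ _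
  have hEc : ContinuousOn (evolution H) (Icc (0 : ℝ) t) :=
    continuousOn_timeOrderedExp ht.le hA hS hAc
  have hEd : ∀ τ ∈ Ioo (0 : ℝ) t, ContinuousAt H τ →
      HasDerivAt (evolution H) (-Complex.I • H τ * evolution H τ) τ := fun τ hτ hc =>
    hasDerivAt_timeOrderedExp hA hS hAc hτ (hc.const_smul (-Complex.I))
  refine ⟨⟨hE0, hEc, hEd⟩, fun ρ => ?_, ?_⟩
  · have h := intervalIntegrable_qdrift ht.le hherm hint
    constructor
    · rw [intervalIntegrable_iff] at h ⊢
      exact h.apply_continuousLinearMap ρ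
    · exact ContinuousLinearMap.intervalIntegral_apply h ρ
  -- It suffices to bound each element of the set, the bound being nonnegative.
  · refine Real.sSup_le ?_ (by positivity)
    rintro r ⟨B, hB, rfl⟩
    have hK : IntervalIntegrable (fun τ => tensorOne (-Complex.I • H τ)) volume 0 t :=
      hA.clm_comp tensorOneCLM
    have hideal := traceNorm_conj_sub_le (K := fun τ => tensorOne (-Complex.I • H τ))
      (G := fun τ => tensorOne (evolution H τ)) ht.le hS
      (fun τ hτ => by
        rw [← tensorOne_conjTranspose, conjTranspose_neg_I_smul (hherm τ hτ), map_neg])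
      hK (fun τ hτ => tensorOneCLM.continuous.continuousAt.comp (hAc τ hτ))
      (tensorOneCLM.continuous.comp_continuousOn hEc) (by rw [hE0, map_one])
      (fun τ hτ => by
        rw [← map_mul]
        exact tensorOneCLM.hasFDerivAt.comp_hasDerivAt τ (hEd τ hτ.1 (hHc τ hτ))) B
    have hnorm : ∫ τ in (0 : ℝ)..t, ‖tensorOne (-Complex.I • H τ)‖ ≤ normInftyOne H t := by
      refine intervalIntegral.integral_mono_on ht.le hK.norm hint.norm fun τ _ => ?_
      refine (norm_tensorOne_le _).trans_eq ?_
      rw [norm_smul, norm_neg, Complex.norm_I, one_mul]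
    have hq := traceNorm_qdrift_sub_le ht hherm hne hint B
    -- Both arguments subtract the same first-order expansion, which cancels in their difference.
    have hsplit := traceNorm_sub_le
      (tensorOne (evolution H t) * B * (tensorOne (evolution H t))ᴴ - B -
        ∫ τ in (0 : ℝ)..t, (tensorOne (-Complex.I • H τ) * B - B * tensorOne (-Complex.I • H τ)))
      (tensorId (qdriftChannel H t : Matrix n n ℂ →ₗ[ℂ] Matrix n n ℂ) B - B -
        ∫ τ in (0 : ℝ)..t, (tensorOne (-Complex.I • H τ) * B - B * tensorOne (-Complex.I • H τ)))
    rw [sub_sub_sub_cancel_right, sub_sub_sub_cancel_right, ← tensorOne_conjTranspose,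
      ← tensorId_mulLeftRight] at hsplit
    rw [← tensorOne_conjTranspose, ← tensorId_mulLeftRight] at hideal
    have hn0 : 0 ≤ ∫ τ in (0 : ℝ)..t, ‖tensorOne (-Complex.I • H τ)‖ :=
      integral_norm_nonneg_of_le ht.le
    have hsq := pow_le_pow_left₀ hn0 hnorm 2
    have hB0 := traceNorm_nonneg B
    -- `tensorId` of a difference is the difference of the `tensorId`s by definition.
    have hmain : traceNorm (tensorId ((idealChannel H t - qdriftChannel H t :
        Matrix n n ℂ →L[ℂ] Matrix n n ℂ) : Matrix n n ℂ →ₗ[ℂ] Matrix n n ℂ) B) ≤ _ := hsplit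
    nlinarith [sq_nonneg (normInftyOne H t)]
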